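/- Let $n\in\mathbb N$, $n\ge 2$, let $c_1,\dots,c_n>0$ and $0\le a_1\le a_2\le\dots\le a_n<\infty$ be real numbers, and let $N_1,\dots,N_n$ be $n$ disjoint copies of $(0,+\infty)$. Let $\mathbb K\in\{\mathbb R,\mathbb C\}$ and let $H=\prod_{k=1}^n L^2(N_k;\mathbb K)$ be the Hilbert space with scalar product $(u,v)_H=\sum_{k=1}^n (u_k,v_k)_{L^2(N_k)}$. Define the operator $A:D(A)\to H$ by $$D(A)=\Big\{(u_k)_{k=1}^n\in\prod_{k=1}^n H^2(N_k)\;:\;(T_0)\text{ and }(T_1)\text{ hold}\Big\},\qquad A(u_k)_{k=1}^n=(-c_k\,\partial_x^2u_k+a_ku_k)_{k=1}^n,$$ where the derivatives are weak derivatives, $H^2(N_k)$ is the Sobolev space of all $f\in L^2(N_k;\mathbb K)$ with $f',f''\in L^2(N_k;\mathbb K)$, and - $(T_0)$: $(u_k)_{k=1}^n\in\prod_{k=1}^n C^0([0,\infty))$ satisfies $u_i(0)=u_k(0)$ for all $i,k\in\{1,\dots,n\}$; - $(T_1)$: $(u_k)_{k=1}^n\in\prod_{k=1}^n C^1([0,\infty))$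 satisfies $\sum_{k=1}^n c_k\,\partial_xu_k(0^+)=0$ (elements of $H^2(N_k)$ being identified with their representatives continuous up to $0$). Then $A$ is self-adjoint, that is, $D(A)$ is dense in $H$ and $A=A^*$ including equality of domains. Moreover, its spectrum $\sigma(A)$, the set of all $z\in\mathbb K$ for which $zI-A:D(A)\to H$ is not a bijection with bounded inverse, satisfies $\sigma(A)\subset[a_1,+\infty)$. -/

import Mathlib

open MeasureTheory
open scoped ContDiff

namespace StarGraph

/-- The space `L²(0, ∞)` of `𝕜`-valued functions on one branch, with Lebesgue measure. -/
abbrev L2Branch (𝕜 : Type*) [RCLike 𝕜] : Type _ :=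
  Lp 𝕜 2 (volume.restrict (Set.Ioi (0 : ℝ)))

/-- The Hilbert space `H = ∏ₖ L²(Nₖ)`, with `(u, v)_H = ∑ₖ (uₖ, vₖ)`. -/
abbrev L2Star (𝕜 : Type*) [RCLike 𝕜] (n : ℕ) : Type _ :=
  PiLp 2 (fun _ : Fin n => L2Branch 𝕜)

section

variable {𝕜 : Type*} [RCLike 𝕜]

/-- `g ∈ L²(0, ∞)` is the weak (distributional) derivative of `f ∈ L²(0, ∞)`:
`∫ φ' f = - ∫ φ g` for every smooth `φ` with compact support in the open half-line. -/
def IsWeakDeriv (f g : L2Branch 𝕜) : Prop :=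
  ∀ φ : ℝ → ℝ, ContDiff ℝ ∞ φ → HasCompactSupport φ → tsupport φ ⊆ Set.Ioi 0 →
    ∫ x in Set.Ioi (0 : ℝ), deriv φ x • f x = - ∫ x in Set.Ioi (0 : ℝ), φ x • g x

/-- Membership in the Sobolev space `H²(0, ∞)`: `f`, `f'`, `f''` all lie in `L²(0, ∞)`. -/
def MemH2 (f : L2Branch 𝕜) : Prop :=
  ∃ g : L2Branch 𝕜, IsWeakDeriv f g ∧ ∃ h : L2Branch 𝕜, IsWeakDeriv g h

open Classical in
/-- The weak derivative of `f` if it exists in `L²(0, ∞)` (it is then unique), otherwise `0`. -/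
noncomputable def weakDeriv (f : L2Branch 𝕜) : L2Branch 𝕜 :=
  if h : ∃ g, IsWeakDeriv f g then h.choose else 0

/-- Condition `(T₀)`: the components are continuous up to the endpoint and take a common value
there. -/
def T0 {n : ℕ} (u : L2Star 𝕜 n) : Prop :=
  ∃ v : Fin n → ℝ → 𝕜,
    (∀ k, ContinuousOn (v k) (Set.Ici 0) ∧
      u k =ᵐ[volume.restrict (Set.Ioi (0 : ℝ))] v k) ∧
    ∀ i k, v i 0 = v k 0

/-- Condition `(T₁)`: the components are continuously differentiable up to the endpoint, and
`∑ₖ cₖ uₖ'(0⁺) = 0`. -/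
def T1 {n : ℕ} (c : Fin n → ℝ) (u : L2Star 𝕜 n) : Prop :=
  ∃ v : Fin n → ℝ → 𝕜,
    (∀ k, ContDiffOn ℝ 1 (v k) (Set.Ici 0) ∧
      u k =ᵐ[volume.restrict (Set.Ioi (0 : ℝ))] v k) ∧
    ∑ k, (c k : 𝕜) * derivWithin (v k) (Set.Ici 0) 0 = 0

/-! Well-definedness: uniqueness and linearity of the weak derivative. -/

lemma locInt (f : L2Branch 𝕜) : LocallyIntegrable f (volume.restrict (Set.Ioi (0 : ℝ))) :=
  (Lp.memLp f).locallyIntegrable (by norm_num)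

lemma integrable_smul {φ : ℝ → ℝ} (hφ : Continuous φ) (hs : HasCompactSupport φ)
    (f : L2Branch 𝕜) :
    Integrable (fun x => φ x • f x) (volume.restrict (Set.Ioi (0 : ℝ))) :=
  (locInt f).integrable_smul_left_of_hasCompactSupport hφ hs

lemma IsWeakDeriv.unique {f g h : L2Branch 𝕜} (hg : IsWeakDeriv f g) (hh : IsWeakDeriv f h) :
    g = h := by
  have key := isOpen_Ioi.ae_eq_zero_of_integral_contDiff_smul_eq_zero
    (μ := volume.restrict (Set.Ioi (0 : ℝ))) (U := Set.Ioi (0 : ℝ)) (f := fun x => g x - h x)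
    (((locInt g).sub (locInt h)).locallyIntegrableOn _) (by
      intro φ h1 h2 h3
      have e := (hg φ h1 h2 h3).symm.trans (hh φ h1 h2 h3)
      simp only [smul_sub]
      rw [integral_sub (integrable_smul h1.continuous h2 g) (integrable_smul h1.continuous h2 h),
        neg_injective e, sub_self])
  apply Lp.ext
  filter_upwards [key, ae_restrict_mem measurableSet_Ioi] with x hx hx0
  exact sub_eq_zero.mp (hx hx0)

lemma weakDeriv_eq {f g : L2Branch 𝕜} (h : IsWeakDeriv f g) : weakDeriv f = g := by
  have hex : ∃ g, IsWeakDeriv f g := ⟨g, h⟩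
  rw [weakDeriv, dif_pos hex]
  exact hex.choose_spec.unique h

lemma IsWeakDeriv.add {f₁ f₂ g₁ g₂ : L2Branch 𝕜} (h₁ : IsWeakDeriv f₁ g₁)
    (h₂ : IsWeakDeriv f₂ g₂) : IsWeakDeriv (f₁ + f₂) (g₁ + g₂) := by
  intro φ s1 s2 s3
  have s1' : Continuous (deriv φ) := s1.continuous_deriv (by simp)
  have e1 : ∫ x in Set.Ioi (0 : ℝ), deriv φ x • (f₁ + f₂ : L2Branch 𝕜) x =
      ∫ x in Set.Ioi (0 : ℝ), (deriv φ x • f₁ x + deriv φ x • f₂ x) := by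
    apply integral_congr_ae
    filter_upwards [Lp.coeFn_add f₁ f₂] with x hx
    rw [hx, Pi.add_apply, smul_add]
  have e2 : ∫ x in Set.Ioi (0 : ℝ), φ x • (g₁ + g₂ : L2Branch 𝕜) x =
      ∫ x in Set.Ioi (0 : ℝ), (φ x • g₁ x + φ x • g₂ x) := by
    apply integral_congr_ae
    filter_upwards [Lp.coeFn_add g₁ g₂] with x hx
    rw [hx, Pi.add_apply, smul_add]
  rw [e1, e2, integral_add (integrable_smul s1' s2.deriv f₁) (integrable_smul s1' s2.deriv f₂),
    integral_add (integrable_smul s1.continuous s2 g₁) (integrable_smul s1.continuous s2 g₂),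
    h₁ φ s1 s2 s3, h₂ φ s1 s2 s3]
  ring

lemma IsWeakDeriv.smul (r : 𝕜) {f g : L2Branch 𝕜} (h : IsWeakDeriv f g) :
    IsWeakDeriv (r • f) (r • g) := by
  intro φ s1 s2 s3
  have e1 : ∫ x in Set.Ioi (0 : ℝ), deriv φ x • (r • f : L2Branch 𝕜) x =
      ∫ x in Set.Ioi (0 : ℝ), r • (deriv φ x • f x) := by
    apply integral_congr_ae
    filter_upwards [Lp.coeFn_smul r f] with x hx
    rw [hx, Pi.smul_apply, smul_comm]
  have e2 : ∫ x in Set.Ioi (0 : ℝ), φ x • (r • g : L2Branch 𝕜) x =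
      ∫ x in Set.Ioi (0 : ℝ), r • (φ x • g x) := by
    apply integral_congr_ae
    filter_upwards [Lp.coeFn_smul r g] with x hx
    rw [hx, Pi.smul_apply, smul_comm]
  rw [e1, e2, integral_smul, integral_smul, h φ s1 s2 s3, smul_neg]

lemma MemH2.add {f g : L2Branch 𝕜} (hf : MemH2 f) (hg : MemH2 g) : MemH2 (f + g) := by
  obtain ⟨f₁, hf₁, f₂, hf₂⟩ := hf
  obtain ⟨g₁, hg₁, g₂, hg₂⟩ := hg
  exact ⟨_, hf₁.add hg₁, _, hf₂.add hg₂⟩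

lemma MemH2.smul (r : 𝕜) {f : L2Branch 𝕜} (hf : MemH2 f) : MemH2 (r • f) := by
  obtain ⟨f₁, hf₁, f₂, hf₂⟩ := hf
  exact ⟨_, hf₁.smul r, _, hf₂.smul r⟩

lemma weakDeriv2_add {f g : L2Branch 𝕜} (hf : MemH2 f) (hg : MemH2 g) :
    weakDeriv (weakDeriv (f + g)) = weakDeriv (weakDeriv f) + weakDeriv (weakDeriv g) := by
  obtain ⟨f₁, hf₁, f₂, hf₂⟩ := hf
  obtain ⟨g₁, hg₁, g₂, hg₂⟩ := hg
  rw [weakDeriv_eq (hf₁.add hg₁), weakDeriv_eq (hf₂.add hg₂), weakDeriv_eq hf₁, weakDeriv_eq hg₁,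
    weakDeriv_eq hf₂, weakDeriv_eq hg₂]

lemma weakDeriv2_smul (r : 𝕜) {f : L2Branch 𝕜} (hf : MemH2 f) :
    weakDeriv (weakDeriv (r • f)) = r • weakDeriv (weakDeriv f) := by
  obtain ⟨f₁, hf₁, f₂, hf₂⟩ := hf
  rw [weakDeriv_eq (hf₁.smul r), weakDeriv_eq (hf₂.smul r), weakDeriv_eq hf₁, weakDeriv_eq hf₂]

lemma T0.add {n : ℕ} {u w : L2Star 𝕜 n} (hu : T0 u) (hw : T0 w) : T0 (u + w) := by
  obtain ⟨v, hv, hv0⟩ := hu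
  obtain ⟨z, hz, hz0⟩ := hw
  refine ⟨fun k x => v k x + z k x, fun k => ⟨(hv k).1.add (hz k).1, ?_⟩, fun i k => ?_⟩
  · filter_upwards [Lp.coeFn_add (u k) (w k), (hv k).2, (hz k).2] with x h1 h2 h3
    rw [PiLp.add_apply, h1, Pi.add_apply, h2, h3]
  · simp only [hv0 i k, hz0 i k]

lemma T0.smul {n : ℕ} (r : 𝕜) {u : L2Star 𝕜 n} (hu : T0 u) : T0 (r • u) := by
  obtain ⟨v, hv, hv0⟩ := hu
  refine ⟨fun k x => r * v k x, fun k => ⟨continuousOn_const.mul (hv k).1, ?_⟩, fun i k => ?_⟩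
  · filter_upwards [Lp.coeFn_smul r (u k), (hv k).2] with x h1 h2
    rw [PiLp.smul_apply, h1, Pi.smul_apply, h2, smul_eq_mul]
  · simp only [hv0 i k]

lemma T1.add {n : ℕ} {c : Fin n → ℝ} {u w : L2Star 𝕜 n} (hu : T1 c u) (hw : T1 c w) :
    T1 c (u + w) := by
  obtain ⟨v, hv, hv0⟩ := hu
  obtain ⟨z, hz, hz0⟩ := hw
  refine ⟨fun k x => v k x + z k x, fun k => ⟨(hv k).1.add (hz k).1, ?_⟩, ?_⟩
  · filter_upwards [Lp.coeFn_add (u k) (w k), (hv k).2, (hz k).2] with x h1 h2 h3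
    rw [PiLp.add_apply, h1, Pi.add_apply, h2, h3]
  · have e : ∀ k, derivWithin (fun x => v k x + z k x) (Set.Ici 0) 0 =
        derivWithin (v k) (Set.Ici 0) 0 + derivWithin (z k) (Set.Ici 0) 0 := fun k =>
      derivWithin_fun_add ((hv k).1.differentiableOn (by simp) 0 Set.self_mem_Ici)
        ((hz k).1.differentiableOn (by simp) 0 Set.self_mem_Ici)
    simp only [e, mul_add, Finset.sum_add_distrib, hv0, hz0, add_zero]

lemma T1.smul {n : ℕ} {c : Fin n → ℝ} (r : 𝕜) {u : L2Star 𝕜 n} (hu : T1 c u) :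
    T1 c (r • u) := by
  obtain ⟨v, hv, hv0⟩ := hu
  refine ⟨fun k x => r * v k x, fun k => ⟨contDiffOn_const.mul (hv k).1, ?_⟩, ?_⟩
  · filter_upwards [Lp.coeFn_smul r (u k), (hv k).2] with x h1 h2
    rw [PiLp.smul_apply, h1, Pi.smul_apply, h2, smul_eq_mul]
  · have e : ∀ k, derivWithin (fun x => r * v k x) (Set.Ici 0) 0 =
        r * derivWithin (v k) (Set.Ici 0) 0 := fun k =>
      derivWithin_const_mul r ((hv k).1.differentiableOn (by simp) 0 Set.self_mem_Ici)
    simp only [e, mul_left_comm _ r, ← Finset.mul_sum, hv0, mul_zero]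

lemma isWeakDeriv_zero : IsWeakDeriv (0 : L2Branch 𝕜) 0 := by
  have e : ∀ ψ : ℝ → ℝ, ∫ x in Set.Ioi (0 : ℝ), ψ x • (0 : L2Branch 𝕜) x = 0 := fun ψ => by
    rw [← integral_zero ℝ 𝕜 (μ := volume.restrict (Set.Ioi (0 : ℝ)))]
    apply integral_congr_ae
    filter_upwards [Lp.coeFn_zero 𝕜 2 (volume.restrict (Set.Ioi (0 : ℝ)))] with x hx
    rw [hx, Pi.zero_apply, smul_zero]
  intro φ _ _ _
  rw [e, e, neg_zero]

end

/-- The domain `D(A)`: all `u ∈ ∏ₖ H²(Nₖ)` satisfying `(T₀)` and `(T₁)`. -/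
def domain (𝕜 : Type*) [RCLike 𝕜] {n : ℕ} (c : Fin n → ℝ) : Submodule 𝕜 (L2Star 𝕜 n) where
  carrier := {u | (∀ k, MemH2 (u k)) ∧ T0 u ∧ T1 c u}
  zero_mem' := by
    refine ⟨fun k => ⟨0, isWeakDeriv_zero, 0, isWeakDeriv_zero⟩,
      ⟨fun _ _ => 0, fun k => ⟨continuousOn_const, Lp.coeFn_zero _ _ _⟩, fun _ _ => rfl⟩,
      ⟨fun _ _ => 0, fun k => ⟨contDiffOn_const, Lp.coeFn_zero _ _ _⟩, by simp⟩⟩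
  add_mem' hu hw :=
    ⟨fun k => (hu.1 k).add (hw.1 k), hu.2.1.add hw.2.1, hu.2.2.add hw.2.2⟩
  smul_mem' r _ hu := ⟨fun k => (hu.1 k).smul r, hu.2.1.smul r, hu.2.2.smul r⟩

/-- The operator `A u = (-cₖ uₖ'' + aₖ uₖ)ₖ` with domain `D(A)`. -/
noncomputable def operator (𝕜 : Type*) [RCLike 𝕜] {n : ℕ} (c a : Fin n → ℝ) :
    L2Star 𝕜 n →ₗ.[𝕜] L2Star 𝕜 n where
  domain := domain 𝕜 c
  toFun :=
    { toFun := fun u => WithLp.toLp 2 fun k =>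
        -(c k : 𝕜) • weakDeriv (weakDeriv ((u : L2Star 𝕜 n) k)) +
          (a k : 𝕜) • (u : L2Star 𝕜 n) k
      map_add' := fun u w => by
        ext1 k
        simp only [Submodule.coe_add, PiLp.add_apply, weakDeriv2_add (u.2.1 k) (w.2.1 k), smul_add]
        abel
      map_smul' := fun r u => by
        ext1 k
        simp only [Submodule.coe_smul, PiLp.smul_apply, weakDeriv2_smul r (u.2.1 k), smul_add,
          RingHom.id_apply, smul_comm r] }

/-- The resolvent set `ρ(T)` of an unbounded operator: those `z` for which `zI - T : D(T) → E` has
a two-sided inverse `R(z, T)` which is a bounded operator on `E`. -/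
def resolventSet {𝕜 E : Type*} [RCLike 𝕜] [NormedAddCommGroup E] [NormedSpace 𝕜 E]
    (T : E →ₗ.[𝕜] E) : Set 𝕜 :=
  {z | ∃ R : E →L[𝕜] E,
    (∀ x : T.domain, R (z • (x : E) - T x) = x) ∧
    ∀ y : E, ∃ x : T.domain, (x : E) = R y ∧ z • (x : E) - T x = y}

/-- The spectrum `σ(T)`, the complement of the resolvent set. -/
def spectrum {𝕜 E : Type*} [RCLike 𝕜] [NormedAddCommGroup E] [NormedSpace 𝕜 E]
    (T : E →ₗ.[𝕜] E) : Set 𝕜 :=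
  (resolventSet T)ᶜ

end StarGraph

/-! ### Symmetric operators bounded below: self-adjointness and spectrum from one surjectivity. -/

section SelfAdjointCriterion

open LinearPMap

variable {𝕜 E : Type*} [RCLike 𝕜] [NormedAddCommGroup E] [InnerProductSpace 𝕜 E]
  {T : E →ₗ.[𝕜] E}

/-! Integrating by parts on each branch turns `(Au, w)` into the sum of `cₖ (uₖ', wₖ') + aₖ (uₖ,
wₖ)` plus boundary terms at the vertex. By `T0` the value of `w` there is common and factors out,
leaving the flux sum of `u`, which is zero by `T1`. So `A` is symmetric and bounded below by the
smallest potential `a₁` (`inner_operator_apply`, `operator_isFormalAdjoint`,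
`le_re_inner_operator`).

Such an operator is self-adjoint with spectrum in `[a₁, ∞)` as soon as `A - l` is onto for one real
`l < a₁`. Surjectivity forces the domain to be dense and leaves no room for a larger adjoint. Off
`[a₁, ∞)` the numerical range gives a lower bound for `z - A`, so this map is injective with closed
range, and the same bound at the conjugate of `z` makes the range dense.

Surjectivity (`exists_operator_sub_smul_eq`) is solved branch by branch. A Hilbert space projection
gives a particular solution with unspecified boundary data, and multiples of a decaying exponential
then enforce the vertex conditions. The link between weak derivatives and boundary values is
`IsWeakDeriv.exists_isH2Rep`, which rests on the du Bois-Reymond lemma. -/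

lemma exists_pos_le_norm_sub_ofReal {a : ℝ} {z : 𝕜}
    (hz : z ∉ (fun r : ℝ => (r : 𝕜)) '' Set.Ici a) :
    ∃ δ > 0, ∀ r : ℝ, a ≤ r → δ ≤ ‖z - (r : 𝕜)‖ := by
  by_cases him : RCLike.im z = 0
  · have hza : RCLike.re z < a := by
      by_contra h
      refine hz ⟨RCLike.re z, not_lt.mp h, ?_⟩
      conv_rhs => rw [← RCLike.re_add_im z, him]
      simp
    refine ⟨a - RCLike.re z, sub_pos.mpr hza, fun r hr => ?_⟩
    have h1 := RCLike.abs_re_le_norm (z - (r : 𝕜))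
    rw [_root_.map_sub, RCLike.ofReal_re] at h1
    have := neg_abs_le (RCLike.re z - r)
    linarith
  · refine ⟨|RCLike.im z|, abs_pos.mpr him, fun r _ => ?_⟩
    have h1 := RCLike.abs_im_le_norm (z - (r : 𝕜))
    rwa [_root_.map_sub, RCLike.ofReal_im, sub_zero] at h1

/-- By symmetry the Rayleigh quotient of `x` is real, hence a point of `[a, ∞)`. Pairing `(z - T) x`
with `x` gives `z` minus this quotient, times `‖x‖ ^ 2`, and Cauchy-Schwarz concludes. -/
lemma LinearPMap.IsFormalAdjoint.le_norm_smul_sub (hT : T.IsFormalAdjoint T) {a δ : ℝ} {z : 𝕜}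
    (hδ : ∀ r : ℝ, a ≤ r → δ ≤ ‖z - (r : 𝕜)‖)
    (hb : ∀ x : T.domain, a * ‖(x : E)‖ ^ 2 ≤ RCLike.re (inner 𝕜 (x : E) (T x)))
    (x : T.domain) : δ * ‖(x : E)‖ ≤ ‖z • (x : E) - T x‖ := by
  rcases eq_or_ne (x : E) 0 with hx | hx
  · simp [hx]
  have hpos : 0 < ‖(x : E)‖ := norm_pos_iff.mpr hx
  have hreal : inner 𝕜 (x : E) (T x) = (RCLike.re (inner 𝕜 (x : E) (T x)) : 𝕜) := by
    refine (RCLike.conj_eq_iff_re.mp ?_).symm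
    rw [inner_conj_symm, hT x x]
  set ρ := RCLike.re (inner 𝕜 (x : E) (T x)) with hρ
  have h1 : inner 𝕜 (x : E) (z • (x : E) - T x) =
      (z - ((ρ / ‖(x : E)‖ ^ 2 : ℝ) : 𝕜)) * (‖(x : E)‖ : 𝕜) ^ 2 := by
    rw [inner_sub_right, inner_smul_right, hreal, inner_self_eq_norm_sq_to_K]
    have : (‖(x : E)‖ : 𝕜) ≠ 0 := by exact_mod_cast hpos.ne'
    push_cast
    field_simp
  have h2 := norm_inner_le_norm (𝕜 := 𝕜) (x : E) (z • (x : E) - T x)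
  have h3 := hδ (ρ / ‖(x : E)‖ ^ 2) (by rw [le_div_iff₀ (by positivity)]; exact hb x)
  rw [h1, norm_mul, norm_pow, RCLike.norm_ofReal, abs_norm] at h2
  have h4 : δ * ‖(x : E)‖ ^ 2 ≤ ‖(x : E)‖ * ‖z • (x : E) - T x‖ :=
    (mul_le_mul_of_nonneg_right h3 (sq_nonneg _)).trans h2
  refine le_of_mul_le_mul_left ?_ hpos
  linarith

variable [CompleteSpace E]

/-- A vector orthogonal to the domain has the form `(T - l) x`. Pairing it with `x` itself gives `(a
- l) ‖x‖ ^ 2 ≤ 0`, so `x = 0`. -/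
lemma LinearPMap.dense_domain_of_surjective {a l : ℝ}
    (hla : l < a) (hb : ∀ x : T.domain, a * ‖(x : E)‖ ^ 2 ≤ RCLike.re (inner 𝕜 (x : E) (T x)))
    (hs : ∀ y, ∃ x : T.domain, T x - (l : 𝕜) • (x : E) = y) : Dense (T.domain : Set E) := by
  rw [Submodule.dense_iff_topologicalClosure_eq_top, Submodule.topologicalClosure_eq_top_iff,
    Submodule.eq_bot_iff]
  intro w hw
  obtain ⟨x, rfl⟩ := hs w
  have h0 : inner 𝕜 (x : E) (T x - (l : 𝕜) • (x : E)) = 0 := hw x x.2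
  rw [inner_sub_right, inner_smul_right, inner_self_eq_norm_sq_to_K] at h0
  have h1 := congrArg RCLike.re h0
  have h2 : RCLike.re ((l : 𝕜) * (‖(x : E)‖ : 𝕜) ^ 2) = l * ‖(x : E)‖ ^ 2 := by
    rw [← RCLike.ofReal_pow, ← RCLike.ofReal_mul, RCLike.ofReal_re]
  rw [_root_.map_sub, h2, _root_.map_zero] at h1
  have h3 : ‖(x : E)‖ ^ 2 ≤ 0 := by nlinarith [hb x, sq_nonneg ‖(x : E)‖]
  have hx : (x : E) = 0 := by
    rw [← norm_eq_zero]; exact pow_eq_zero_iff two_ne_zero |>.mp (le_antisymm h3 (sq_nonneg _))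
  have hx' : x = 0 := Subtype.ext hx
  rw [hx', map_zero]
  simp

lemma LinearPMap.IsFormalAdjoint.isSelfAdjoint_of_surjective (hT : T.IsFormalAdjoint T) {l : ℝ}
    (hd : Dense (T.domain : Set E))
    (hs : ∀ y, ∃ x : T.domain, T x - (l : 𝕜) • (x : E) = y) : IsSelfAdjoint T := by
  rw [isSelfAdjoint_def]
  refine (LinearPMap.eq_of_le_of_domain_eq (hT.le_adjoint hd) ?_).symm
  refine le_antisymm (hT.le_adjoint hd).1 fun y hy => ?_
  -- Solve `(T - l) x = (T† - l) y` inside the domain of `T`. Then `y - x` is orthogonal to the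
  -- range of `T - l`, which is everything, so `y = x`.
  obtain ⟨x, hx⟩ := hs (T† ⟨y, hy⟩ - (l : 𝕜) • y)
  have key : ∀ w : T.domain, inner 𝕜 (y - x) (T w - (l : 𝕜) • (w : E)) = 0 := by
    intro w
    have e1 := adjoint_isFormalAdjoint hd ⟨y, hy⟩ w
    have e2 := hT x w
    have e3 := congrArg (fun z => inner 𝕜 z (w : E)) hx
    simp only [inner_sub_left, inner_smul_left, RCLike.conj_ofReal] at e3
    simp only [inner_sub_left, inner_sub_right, inner_smul_right]
    rw [← e1, ← e2]
    linear_combination -e3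
  obtain ⟨w, hw⟩ := hs (y - x)
  have h0 := key w
  rw [hw, inner_self_eq_zero, sub_eq_zero] at h0
  rw [h0]
  exact x.2

lemma IsSelfAdjoint.isFormalAdjoint (hT : IsSelfAdjoint T) : T.IsFormalAdjoint T := by
  have h := adjoint_isFormalAdjoint hT.dense_domain
  rwa [isSelfAdjoint_def.mp hT] at h

/-- The lower bound makes preimages of a convergent sequence Cauchy, and the graph of a self-adjoint
operator is closed. -/
lemma IsSelfAdjoint.isClosed_range_smul_sub (hT : IsSelfAdjoint T) {δ : ℝ} (hδ : 0 < δ) {z : 𝕜}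
    (hb : ∀ x : T.domain, δ * ‖(x : E)‖ ≤ ‖z • (x : E) - T x‖) :
    IsClosed (LinearMap.range (z • T.domain.subtype - T.toFun) : Set E) := by
  refine isClosed_of_closure_subset fun y hy => ?_
  obtain ⟨s, hs, hlim⟩ := mem_closure_iff_seq_limit.mp hy
  choose x hx using hs
  have hx' : ∀ k, z • (x k : E) - T (x k) = s k := hx
  have hc : CauchySeq fun k => (x k : E) := by
    have hsc := hlim.cauchySeq
    rw [Metric.cauchySeq_iff] at hsc ⊢
    intro ε hε
    obtain ⟨N, hN⟩ := hsc (δ * ε) (by positivity)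
    refine ⟨N, fun m hm k hk => ?_⟩
    have h1 := hN m hm k hk
    have h2 := hb (x m - x k)
    rw [dist_eq_norm] at h1 ⊢
    have e : z • ((x m - x k : T.domain) : E) - T (x m - x k) = s m - s k := by
      rw [← hx' m, ← hx' k, LinearPMap.map_sub, Submodule.coe_sub, smul_sub]
      abel
    rw [e, Submodule.coe_sub] at h2
    exact lt_of_mul_lt_mul_left (h2.trans_lt h1) hδ.le
  obtain ⟨x₀, hx₀⟩ := cauchySeq_tendsto_of_complete hc
  have hTlim : Filter.Tendsto (fun k => T (x k)) Filter.atTop (nhds (z • x₀ - y)) := by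
    have : (fun k => T (x k)) = fun k => z • (x k : E) - s k := by
      funext k; rw [← hx' k]; abel
    rw [this]
    exact (hx₀.const_smul z).sub hlim
  have hg : (x₀, z • x₀ - y) ∈ (T.graph : Set (E × E)) :=
    hT.isClosed.mem_of_tendsto (hx₀.prodMk_nhds hTlim)
      (Filter.Eventually.of_forall fun k => T.mem_graph (x k))
  obtain ⟨w, hw1, hw2⟩ := T.mem_graph_iff.mp hg
  refine ⟨w, ?_⟩
  change z • (w : E) - T w = y
  simp only at hw1 hw2
  rw [hw1, hw2]
  abel

lemma IsSelfAdjoint.mem_resolventSet (hT : IsSelfAdjoint T) {a : ℝ} {z : 𝕜}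
    (hz : z ∉ (fun r : ℝ => (r : 𝕜)) '' Set.Ici a)
    (hb : ∀ x : T.domain, a * ‖(x : E)‖ ^ 2 ≤ RCLike.re (inner 𝕜 (x : E) (T x))) :
    z ∈ StarGraph.resolventSet T := by
  have hF := hT.isFormalAdjoint
  obtain ⟨δ, hδ, hδr⟩ := exists_pos_le_norm_sub_ofReal hz
  have hlow := hF.le_norm_smul_sub hδr hb
  have hδc : ∀ r : ℝ, a ≤ r → δ ≤ ‖(starRingEnd 𝕜 z) - (r : 𝕜)‖ := fun r hr => by
    rw [← RCLike.norm_conj, _root_.map_sub, RCLike.conj_conj, RCLike.conj_ofReal]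
    exact hδr r hr
  have hlowc := hF.le_norm_smul_sub hδc hb
  set S : T.domain →ₗ[𝕜] E := z • T.domain.subtype - T.toFun with hS
  have hSapp : ∀ x, S x = z • (x : E) - T x := fun _ => rfl
  have hrange : LinearMap.range S = ⊤ := by
    rw [← (hT.isClosed_range_smul_sub hδ hlow).submodule_topologicalClosure_eq,
      Submodule.topologicalClosure_eq_top_iff, Submodule.eq_bot_iff]
    intro y hy
    -- A vector orthogonal to the range of `z - T` is an eigenvector of `T† = T` for the conjugate
    -- of `z`, or zero; `hlowc` rules out the former.
    have hy' : ∀ x : T.domain, inner 𝕜 (starRingEnd 𝕜 z • y) (x : E) = inner 𝕜 y (T x) := by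
      intro x
      have h0 : inner 𝕜 y (z • (x : E) - T x) = 0 := by
        have h := hy _ ⟨x, rfl⟩
        change inner 𝕜 (z • (x : E) - T x) y = 0 at h
        rw [← inner_conj_symm, h, _root_.map_zero]
      rw [inner_sub_right, inner_smul_right, sub_eq_zero] at h0
      rw [inner_smul_left, RCLike.conj_conj, h0]
    have hyd : y ∈ T†.domain := mem_adjoint_domain_of_exists y ⟨_, hy'⟩
    have hval := adjoint_apply_eq hT.dense_domain ⟨y, hyd⟩ hy'
    have hyT : ∃ w : T.domain, (w : E) = y ∧ T w = starRingEnd 𝕜 z • y := by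
      have hg := (T†).mem_graph ⟨y, hyd⟩
      rw [hval] at hg
      simp only [isSelfAdjoint_def.mp hT] at hg
      exact T.mem_graph_iff.mp hg
    obtain ⟨w, rfl, hw⟩ := hyT
    have h1 := hlowc w
    rw [hw, sub_self, norm_zero] at h1
    exact norm_le_zero_iff.mp (nonpos_of_mul_nonpos_right h1 hδ)
  have hinj : Function.Injective S := by
    rw [← LinearMap.ker_eq_bot, Submodule.eq_bot_iff]
    intro x hx
    have h1 := hlow x
    rw [← hSapp, LinearMap.mem_ker.mp hx, norm_zero] at h1
    exact Subtype.ext (norm_le_zero_iff.mp (nonpos_of_mul_nonpos_right h1 hδ))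
  let e : T.domain ≃ₗ[𝕜] E := LinearEquiv.ofBijective S ⟨hinj, LinearMap.range_eq_top.mp hrange⟩
  have he : ∀ x, e x = z • (x : E) - T x := fun _ => rfl
  refine ⟨(T.domain.subtype ∘ₗ e.symm.toLinearMap).mkContinuous δ⁻¹ fun y => ?_,
    fun x => ?_, fun y => ⟨e.symm y, rfl, ?_⟩⟩
  · have h1 := hlow (e.symm y)
    rw [← he, e.apply_symm_apply] at h1
    change ‖((e.symm y : T.domain) : E)‖ ≤ δ⁻¹ * ‖y‖
    rw [inv_mul_eq_div, le_div_iff₀ hδ, mul_comm]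
    exact h1
  · change ((e.symm (z • (x : E) - T x) : T.domain) : E) = x
    rw [← he, e.symm_apply_apply]
  · rw [← he, e.apply_symm_apply]

/-- A symmetric operator which is bounded below by `a` and for which `T - l` is onto for some real
`l < a` is self-adjoint, with spectrum contained in `[a, ∞)`. -/
theorem LinearPMap.IsFormalAdjoint.isSelfAdjoint_and_spectrum_subset (hT : T.IsFormalAdjoint T)
    {a l : ℝ} (hla : l < a)
    (hb : ∀ x : T.domain, a * ‖(x : E)‖ ^ 2 ≤ RCLike.re (inner 𝕜 (x : E) (T x)))
    (hs : ∀ y, ∃ x : T.domain, T x - (l : 𝕜) • (x : E) = y) :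
    IsSelfAdjoint T ∧ StarGraph.spectrum T ⊆ (fun r : ℝ => (r : 𝕜)) '' Set.Ici a := by
  have hsa := hT.isSelfAdjoint_of_surjective (dense_domain_of_surjective hla hb hs) hs
  refine ⟨hsa, fun z hz => ?_⟩
  by_contra h
  exact hz (hsa.mem_resolventSet h hb)

end SelfAdjointCriterion

/-! ### Integration by parts for primitives of integrable functions. -/

section Primitive

open Filter Topology

/-- Increments of the primitive of `f` are dominated by those of the primitive of `‖f‖`, a
real-valued absolutely continuous function. -/
lemma IntervalIntegrable.absolutelyContinuousOnInterval_primitive {E : Type*}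
    [NormedAddCommGroup E] [NormedSpace ℝ E] {f : ℝ → E} {a b c : ℝ}
    (h : IntervalIntegrable f volume a b) (hc : c ∈ Set.uIcc a b) :
    AbsolutelyContinuousOnInterval (fun x => ∫ v in c..x, f v) a b := by
  have hn := h.norm.absolutelyContinuousOnInterval_intervalIntegral hc
  unfold AbsolutelyContinuousOnInterval at hn ⊢
  refine squeeze_zero' (Eventually.of_forall fun I => Finset.sum_nonneg fun _ _ => dist_nonneg)
    ?_ hn
  have : ∀ᶠ I : ℕ × (ℕ → ℝ × ℝ) in AbsolutelyContinuousOnInterval.totalLengthFilter ⊓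
      𝓟 (AbsolutelyContinuousOnInterval.disjWithin a b),
      I ∈ AbsolutelyContinuousOnInterval.disjWithin a b := eventually_inf_principal.mpr (by simp)
  filter_upwards [this] with I hI
  refine Finset.sum_le_sum fun i hi => ?_
  have hI1 := hI.1 i hi
  have hint : ∀ y ∈ Set.uIcc a b, IntervalIntegrable f volume c y := fun y hy =>
    h.mono_set (Set.uIcc_subset_uIcc hc hy)
  rw [dist_eq_norm, Real.dist_eq,
    intervalIntegral.integral_interval_sub_left (hint _ hI1.1) (hint _ hI1.2),
    intervalIntegral.integral_interval_sub_left (hint _ hI1.1).norm (hint _ hI1.2).norm]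
  exact intervalIntegral.norm_integral_le_abs_integral_norm

variable {𝕜 : Type*} [RCLike 𝕜]

lemma intervalIntegral_mul_add_mul_of_primitive {p q P G : ℝ → 𝕜} {R : ℝ} (hR : 0 ≤ R)
    (hp : IntervalIntegrable p volume 0 R) (hq : IntervalIntegrable q volume 0 R)
    (hP : ∀ x, 0 ≤ x → P x = P 0 + ∫ t in 0..x, p t)
    (hG : ∀ x, 0 ≤ x → G x = G 0 + ∫ t in 0..x, q t) :
    ∫ t in 0..R, (p t * G t + P t * q t) = P R * G R - P 0 * G 0 := by
  -- `P` and `G` are controlled only on `[0, ∞)`, so work with the primitives themselves. Their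
  -- product minus the primitive of `p G' + P' q` is absolutely continuous with derivative zero
  -- a.e., hence constant.
  set P' : ℝ → 𝕜 := fun x => P 0 + ∫ t in 0..x, p t with hP'
  set G' : ℝ → 𝕜 := fun x => G 0 + ∫ t in 0..x, q t with hG'
  have h0 : (0 : ℝ) ∈ Set.uIcc 0 R := Set.left_mem_uIcc
  have hc : ∀ z : 𝕜, AbsolutelyContinuousOnInterval (fun _ : ℝ => z) 0 R := fun z =>
    contDiffOn_const.absolutelyContinuousOnInterval
  have aP : AbsolutelyContinuousOnInterval P' 0 R :=
    (hc _).add (hp.absolutelyContinuousOnInterval_primitive h0)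
  have aG : AbsolutelyContinuousOnInterval G' 0 R :=
    (hc _).add (hq.absolutelyContinuousOnInterval_primitive h0)
  have hi : IntervalIntegrable (fun t => p t * G' t + P' t * q t) volume 0 R :=
    (hp.mul_continuousOn aG.continuousOn).add (hq.continuousOn_mul aP.continuousOn)
  have aH := (aP.smul aG).sub (hi.absolutelyContinuousOnInterval_primitive h0)
  obtain ⟨C, hC⟩ := aH.const_of_ae_hasDerivAt_zero (by
    filter_upwards [hp.ae_hasDerivAt_integral, hq.ae_hasDerivAt_integral,
      hi.ae_hasDerivAt_integral] with x h1 h2 h3 hx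
    have d1 : HasDerivAt P' (p x) x := (h1 hx 0 h0).const_add _
    have d2 : HasDerivAt G' (q x) x := (h2 hx 0 h0).const_add _
    have := (d1.mul d2).sub (h3 hx 0 h0)
    rwa [sub_self] at this)
  have e0 := hC 0 h0
  have e1 := hC R Set.right_mem_uIcc
  have hcongr : ∫ t in 0..R, (p t * G t + P t * q t) =
      ∫ t in 0..R, (p t * G' t + P' t * q t) := by
    refine intervalIntegral.integral_congr fun t ht => ?_
    rw [Set.uIcc_of_le hR] at ht
    simp only [hP', hG']
    rw [← hP t ht.1, ← hG t ht.1]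
  rw [hcongr, hP R hR, hG R hR]
  simp only [Pi.sub_apply, Pi.mul_apply, smul_eq_mul, hP', hG',
    intervalIntegral.integral_same, add_zero, sub_zero] at e0 e1 ⊢
  rw [← e0] at e1
  linear_combination -e1

lemma MeasureTheory.MemLp.intervalIntegrable_of_restrict_Ioi {E : Type*} [NormedAddCommGroup E]
    {f : ℝ → E} (hf : MemLp f 2 (volume.restrict (Set.Ioi (0 : ℝ)))) {R : ℝ} (hR : 0 ≤ R) :
    IntervalIntegrable f volume 0 R := by
  rw [intervalIntegrable_iff_integrableOn_Ioc_of_le hR]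
  have h1 : MemLp f 2 (volume.restrict (Set.Ioc 0 R)) :=
    hf.mono_measure (Measure.restrict_mono Set.Ioc_subset_Ioi_self le_rfl)
  exact h1.integrable (by norm_num)

lemma MeasureTheory.MemLp.integral_Ioi_mul_add_mul_of_primitive {p q P G : ℝ → 𝕜}
    (hp : MemLp p 2 (volume.restrict (Set.Ioi (0 : ℝ))))
    (hq : MemLp q 2 (volume.restrict (Set.Ioi (0 : ℝ))))
    (hP2 : MemLp P 2 (volume.restrict (Set.Ioi (0 : ℝ))))
    (hG2 : MemLp G 2 (volume.restrict (Set.Ioi (0 : ℝ))))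
    (hP : ∀ x, 0 ≤ x → P x = P 0 + ∫ t in 0..x, p t)
    (hG : ∀ x, 0 ≤ x → G x = G 0 + ∫ t in 0..x, q t) :
    ∫ t in Set.Ioi (0 : ℝ), (p t * G t + P t * q t) = - (P 0 * G 0) := by
  have hint : IntegrableOn (fun t => p t * G t + P t * q t) (Set.Ioi (0 : ℝ)) :=
    (hp.integrable_mul hG2).add (hP2.integrable_mul hq)
  have hlim := intervalIntegral_tendsto_integral_Ioi 0 hint tendsto_id
  have hlim2 : Tendsto (fun R => P R * G R) atTop
      (𝓝 ((∫ t in Set.Ioi (0 : ℝ), (p t * G t + P t * q t)) + P 0 * G 0)) := by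
    refine (hlim.add_const (P 0 * G 0)).congr' ?_
    filter_upwards [eventually_ge_atTop 0] with R hR
    rw [id, intervalIntegral_mul_add_mul_of_primitive hR
      (hp.intervalIntegrable_of_restrict_Ioi hR) (hq.intervalIntegrable_of_restrict_Ioi hR) hP hG]
    ring
  have hPG : IntegrableOn (fun R => P R * G R) (Set.Ioi (0 : ℝ)) := hP2.integrable_mul hG2
  -- The boundary term at infinity vanishes: `P G` has a limit and is integrable on a half-line of
  -- infinite measure.
  have hzero := IntegrableAtFilter.eq_zero_of_tendsto (μ := volume)
    (⟨Set.Ioi 0, Ioi_mem_atTop 0, hPG⟩ : IntegrableAtFilter (fun R => P R * G R) atTop volume)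
    (fun s hs => by
      obtain ⟨b, hb⟩ := mem_atTop_sets.mp hs
      exact top_le_iff.mp ((Real.volume_Ici (a := b)).symm.le.trans (measure_mono hb)))
    hlim2
  exact eq_neg_of_add_eq_zero_left hzero

end Primitive

/-! ### Weak derivatives and classical representatives on the half-line. -/

namespace StarGraph

open Filter Topology

variable {𝕜 : Type*} [RCLike 𝕜]

/-- `P` is the primitive of `p` on `[0, ∞)`, up to a constant. -/
def IsPrimitive (P p : ℝ → 𝕜) : Prop :=
  ∀ x, 0 ≤ x → P x = P 0 + ∫ t in 0..x, p t

lemma isPrimitive_of_hasDerivAt {P p : ℝ → 𝕜} (h : ∀ x, HasDerivAt P (p x) x)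
    (hp : Continuous p) : IsPrimitive P p := fun x _ => by
  rw [intervalIntegral.integral_eq_sub_of_hasDerivAt (fun t _ => h t) (hp.intervalIntegrable _ _)]
  ring

lemma IsPrimitive.congr {P p q : ℝ → 𝕜} (h : IsPrimitive P p)
    (hpq : p =ᵐ[volume.restrict (Set.Ioi (0 : ℝ))] q) : IsPrimitive P q := fun x hx => by
  rw [h x hx]
  congr 1
  refine intervalIntegral.integral_congr_ae ?_
  filter_upwards [ae_imp_of_ae_restrict hpq] with t ht ht'
  rw [Set.uIoc_of_le hx] at ht'
  exact ht ht'.1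

lemma IsPrimitive.conj {P p : ℝ → 𝕜} (h : IsPrimitive P p) :
    IsPrimitive (fun x => starRingEnd 𝕜 (P x)) (fun x => starRingEnd 𝕜 (p x)) := fun x hx => by
  simp only
  rw [h x hx, map_add, intervalIntegral.integral_of_le hx, intervalIntegral.integral_of_le hx,
    integral_conj]

lemma IsPrimitive.continuousOn_Icc {P p : ℝ → 𝕜} (h : IsPrimitive P p) {R : ℝ} (hR : 0 ≤ R)
    (hp : IntervalIntegrable p volume 0 R) : ContinuousOn P (Set.uIcc 0 R) := by
  have h1 : ContinuousOn (fun x => P 0 + ∫ t in 0..x, p t) (Set.uIcc 0 R) :=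
    continuousOn_const.add
      (hp.absolutelyContinuousOnInterval_primitive Set.left_mem_uIcc).continuousOn
  refine h1.congr fun x hx => h x ?_
  rw [Set.uIcc_of_le hR] at hx
  exact hx.1

lemma exists_continuous_isPrimitive (p : L2Branch 𝕜) :
    ∃ P : ℝ → 𝕜, Continuous P ∧ IsPrimitive P p ∧ P 0 = 0 := by
  have hm : MemLp ((Set.Ioi (0 : ℝ)).indicator p) 2 volume :=
    (memLp_indicator_iff_restrict measurableSet_Ioi).mpr (Lp.memLp p)
  have hl := hm.locallyIntegrable (by norm_num)
  refine ⟨fun x => ∫ t in 0..x, (Set.Ioi (0 : ℝ)).indicator p t,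
    intervalIntegral.continuous_primitive (fun a b =>
      (hl.integrableOn_isCompact isCompact_uIcc).intervalIntegrable) 0, fun x hx => ?_,
    by simp⟩
  simp only [intervalIntegral.integral_same, zero_add]
  refine intervalIntegral.integral_congr_ae (Eventually.of_forall fun t ht => ?_)
  rw [Set.uIoc_of_le hx] at ht
  exact Set.indicator_of_mem (Set.mem_Ioi.mpr ht.1) _

lemma exists_forall_ge_eq_zero {φ : ℝ → ℝ} (hs : HasCompactSupport φ) :
    ∃ R, 0 ≤ R ∧ ∀ x, R < x → φ x = 0 ∧ deriv φ x = 0 := by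
  obtain ⟨R, hR⟩ := hs.isCompact.bddAbove
  have hR' : ∀ x, max R 0 < x → x ∉ tsupport φ := fun x hx h =>
    absurd (hR h) (not_le.mpr ((le_max_left _ _).trans_lt hx))
  refine ⟨max R 0, le_max_right _ _, fun x hx => ⟨image_eq_zero_of_notMem_tsupport (hR' x hx), ?_⟩⟩
  by_contra h
  exact hR' x hx (support_deriv_subset h)

lemma IsPrimitive.integral_deriv_smul {P p : ℝ → 𝕜} (h : IsPrimitive P p)
    (hp : MemLp p 2 (volume.restrict (Set.Ioi (0 : ℝ)))) {φ : ℝ → ℝ} (h1 : ContDiff ℝ ∞ φ)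
    (h2 : HasCompactSupport φ) (h3 : tsupport φ ⊆ Set.Ioi 0) :
    ∫ x in Set.Ioi (0 : ℝ), deriv φ x • P x = - ∫ x in Set.Ioi (0 : ℝ), φ x • p x := by
  obtain ⟨R, hR, hRφ⟩ := exists_forall_ge_eq_zero h2
  have hφ0 : φ 0 = 0 :=
    image_eq_zero_of_notMem_tsupport fun h => lt_irrefl _ (Set.mem_Ioi.mp (h3 h))
  have hφc' : Continuous (deriv φ) := h1.continuous_deriv (by simp)
  have hint : ∀ (θ : ℝ → ℝ) (f : ℝ → 𝕜), (∀ x, R < x → θ x = 0) →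
      ∫ x in Set.Ioi (0 : ℝ), θ x • f x = ∫ x in 0..R, (θ x : 𝕜) * f x := fun θ f hθ => by
    rw [intervalIntegral.integral_of_le hR,
      ← setIntegral_eq_of_subset_of_forall_sdiff_eq_zero measurableSet_Ioi Set.Ioc_subset_Ioi_self
        (f := fun x => (θ x : 𝕜) * f x)]
    · simp only [RCLike.real_smul_eq_coe_mul]
    · intro x hx
      have hx' : R < x := by
        by_contra hc
        exact hx.2 ⟨hx.1, not_lt.mp hc⟩
      rw [hθ x hx', RCLike.ofReal_zero, zero_mul]
  have hpi := hp.intervalIntegrable_of_restrict_Ioi hR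
  have hq : Continuous fun x => ((deriv φ x : ℝ) : 𝕜) := RCLike.continuous_ofReal.comp hφc'
  have hG : Continuous fun x => ((φ x : ℝ) : 𝕜) := RCLike.continuous_ofReal.comp h1.continuous
  have hderiv : ∀ x, HasDerivAt (fun x => ((φ x : ℝ) : 𝕜)) ((deriv φ x : ℝ) : 𝕜) x := fun x =>
    (RCLike.ofRealCLM (K := 𝕜)).hasFDerivAt.comp_hasDerivAt x
      (h1.differentiable (by simp) x).hasDerivAt
  have key := intervalIntegral_mul_add_mul_of_primitive hR hpi (hq.intervalIntegrable 0 R) h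
    (isPrimitive_of_hasDerivAt hderiv hq)
  rw [intervalIntegral.integral_add (hpi.mul_continuousOn hG.continuousOn)
    ((hq.intervalIntegrable 0 R).continuousOn_mul (h.continuousOn_Icc hR hpi)), hφ0] at key
  -- `φ` is known to vanish only strictly beyond `R`; continuity covers `R` itself.
  have hGR : ((φ R : ℝ) : 𝕜) * P R = 0 := by
    have : φ R = 0 := by
      have hcl : IsClosed {x | φ x = 0} := isClosed_eq h1.continuous continuous_const
      have : Set.Ici R ⊆ {x | φ x = 0} := by
        rw [← closure_Ioi]
        exact hcl.closure_subset_iff.mpr fun x hx => (hRφ x hx).1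
      exact this Set.self_mem_Ici
    rw [this]; simp
  rw [hint _ _ fun x hx => (hRφ x hx).2, hint _ _ fun x hx => (hRφ x hx).1]
  simp only [mul_comm _ (P _), mul_comm _ (p _)] at hGR ⊢
  rw [hGR] at key
  simp only [RCLike.ofReal_zero, mul_zero, sub_zero] at key
  exact eq_neg_of_add_eq_zero_right key

lemma isWeakDeriv_of_isPrimitive {u p : L2Branch 𝕜} {F : ℝ → 𝕜}
    (hu : u =ᵐ[volume.restrict (Set.Ioi (0 : ℝ))] F) (h : IsPrimitive F p) : IsWeakDeriv u p := by
  intro φ h1 h2 h3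
  rw [← h.integral_deriv_smul (Lp.memLp p) h1 h2 h3]
  refine integral_congr_ae ?_
  filter_upwards [hu] with x hx
  rw [hx]

/-- The integral over `(-∞, x]` vanishes to the left of the support of `θ`, and to its right because
`θ` has mean zero. -/
lemma exists_test_primitive {θ : ℝ → ℝ} (h1 : ContDiff ℝ ∞ θ) (h2 : HasCompactSupport θ)
    (h3 : tsupport θ ⊆ Set.Ioi 0) (h0 : ∫ x, θ x = 0) :
    ∃ φ : ℝ → ℝ, ContDiff ℝ ∞ φ ∧ HasCompactSupport φ ∧ tsupport φ ⊆ Set.Ioi 0 ∧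
      deriv φ = θ := by
  obtain ⟨a, b, ha, hab⟩ : ∃ a b : ℝ, 0 < a ∧ tsupport θ ⊆ Set.Icc a b := by
    obtain ⟨b, hb⟩ := h2.isCompact.bddAbove
    rcases (tsupport θ).eq_empty_or_nonempty with he | hne
    · exact ⟨1, 1, one_pos, by simp [he]⟩
    · obtain ⟨a, ha⟩ := h2.isCompact.exists_isLeast hne
      exact ⟨a, b, h3 ha.1, fun x hx => ⟨ha.2 hx, hb hx⟩⟩
  have hθ : ∀ x, x ∉ Set.Icc a b → θ x = 0 := fun x hx =>
    image_eq_zero_of_notMem_tsupport fun h => hx (hab h)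
  have hd : ∀ x, HasDerivAt (fun x => ∫ t in Set.Iic x, θ t) (θ x) x := by
    intro x
    have hi : Integrable θ := h1.continuous.integrable_of_hasCompactSupport h2
    have e : (fun x => ∫ t in Set.Iic x, θ t) =
        fun x => (∫ t in Set.Iic 0, θ t) + ∫ t in 0..x, θ t := by
      funext x
      rw [← intervalIntegral.integral_Iic_sub_Iic hi.integrableOn hi.integrableOn]
      ring
    rw [e]
    exact (intervalIntegral.integral_hasDerivAt_right (h1.continuous.intervalIntegrable _ _)
      h1.continuous.stronglyMeasurable.stronglyMeasurableAtFilter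
      h1.continuous.continuousAt).const_add _
  have hderiv : deriv (fun x => ∫ t in Set.Iic x, θ t) = θ := funext fun x => (hd x).deriv
  have hsupp : Function.support (fun x => ∫ t in Set.Iic x, θ t) ⊆ Set.Icc a b := by
    intro x hx
    by_contra hc
    refine hx ?_
    rw [Set.mem_Icc, not_and_or, not_le, not_le] at hc
    rcases hc with hc | hc
    · refine setIntegral_eq_zero_of_forall_eq_zero fun t ht => hθ t fun h => ?_
      exact absurd (h.1.trans ht) (not_le.mpr hc)
    · simp only
      rw [setIntegral_eq_integral_of_forall_compl_eq_zero, h0]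
      intro t ht
      refine hθ t fun h => ht (h.2.trans hc.le)
  have hts : tsupport (fun x => ∫ t in Set.Iic x, θ t) ⊆ Set.Icc a b :=
    closure_minimal hsupp isClosed_Icc
  refine ⟨_, ?_, isCompact_Icc.of_isClosed_subset (isClosed_tsupport _) hts,
    hts.trans fun x hx => ha.trans_le hx.1, hderiv⟩
  rw [contDiff_infty_iff_deriv]
  exact ⟨fun x => (hd x).differentiableAt, by rwa [hderiv]⟩

/-- The lemma of du Bois-Reymond on the half-line. -/
lemma ae_eq_const_of_integral_deriv_smul_eq_zero {h : ℝ → 𝕜}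
    (hl : LocallyIntegrable h (volume.restrict (Set.Ioi (0 : ℝ))))
    (h0 : ∀ φ : ℝ → ℝ, ContDiff ℝ ∞ φ → HasCompactSupport φ → tsupport φ ⊆ Set.Ioi 0 →
      ∫ x in Set.Ioi (0 : ℝ), deriv φ x • h x = 0) :
    ∃ C : 𝕜, h =ᵐ[volume.restrict (Set.Ioi (0 : ℝ))] fun _ => C := by
  -- A fixed bump of mass one supported in `[1, 3]`. Testing `h` against it yields the constant.
  let b : ContDiffBump (2 : ℝ) := ⟨1 / 2, 1, by norm_num, by norm_num⟩
  have hb1 : ContDiff ℝ ∞ (b.normed volume) := b.contDiff_normed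
  have hb2 : HasCompactSupport (b.normed volume) := b.hasCompactSupport_normed
  have hb3 : tsupport (b.normed volume) ⊆ Set.Ioi 0 := by
    rw [b.tsupport_normed_eq]
    intro x hx
    rw [Metric.mem_closedBall, Real.dist_eq, abs_le] at hx
    have : -1 ≤ x - 2 := hx.1
    exact Set.mem_Ioi.mpr (by linarith)
  have hbi : ∫ x, b.normed volume x = 1 := b.integral_normed
  refine ⟨∫ x in Set.Ioi (0 : ℝ), b.normed volume x • h x, ?_⟩
  set C := ∫ x in Set.Ioi (0 : ℝ), b.normed volume x • h x with hC
  have hint : ∀ θ : ℝ → ℝ, ContDiff ℝ ∞ θ → HasCompactSupport θ →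
      Integrable (fun x => θ x • h x) (volume.restrict (Set.Ioi (0 : ℝ))) := fun θ t1 t2 =>
    hl.integrable_smul_left_of_hasCompactSupport t1.continuous t2
  have key := isOpen_Ioi.ae_eq_zero_of_integral_contDiff_smul_eq_zero
    (μ := volume.restrict (Set.Ioi (0 : ℝ))) (U := Set.Ioi (0 : ℝ)) (f := fun x => h x - C)
    ((hl.sub (locallyIntegrable_const C)).locallyIntegrableOn _) (by
      intro θ t1 t2 t3
      -- Subtracting `I` times the bump gives `θ` mean zero, so the difference is the derivative of
      -- an admissible test function.
      set I := ∫ x, θ x with hI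
      have i1 : Integrable θ := t1.continuous.integrable_of_hasCompactSupport t2
      have i2 : Integrable (b.normed volume) := hb1.continuous.integrable_of_hasCompactSupport hb2
      have hts : tsupport (fun x => θ x - I * b.normed volume x) ⊆
          tsupport θ ∪ tsupport (b.normed volume) := by
        refine closure_minimal (fun x hx => ?_) ((isClosed_tsupport _).union (isClosed_tsupport _))
        by_contra hc
        rw [Set.mem_union, not_or] at hc
        refine hx ?_
        simp only
        rw [image_eq_zero_of_notMem_tsupport hc.1, image_eq_zero_of_notMem_tsupport hc.2]
        simp
      obtain ⟨φ, f1, f2, f3, f4⟩ := exists_test_primitive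
        (θ := fun x => θ x - I * b.normed volume x) (t1.sub (contDiff_const.mul hb1))
        ((t2.isCompact.union hb2.isCompact).of_isClosed_subset (isClosed_tsupport _) hts)
        (hts.trans (Set.union_subset t3 hb3)) (by
          rw [integral_sub i1 (i2.const_mul I), integral_const_mul, hbi, mul_one, sub_self])
      have e := h0 φ f1 f2 f3
      rw [f4] at e
      simp only [sub_smul, mul_smul] at e
      have hbI : Integrable (fun x => I • b.normed volume x • h x)
        (volume.restrict (Set.Ioi (0 : ℝ))) := (hint _ hb1 hb2).smul I
      rw [integral_sub (hint θ t1 t2) hbI, integral_smul, ← hC] at e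
      have hset : ∫ x in Set.Ioi (0 : ℝ), θ x = I :=
        setIntegral_eq_integral_of_forall_compl_eq_zero fun x hx =>
          image_eq_zero_of_notMem_tsupport fun hx' => hx (t3 hx')
      simp only [smul_sub]
      rw [integral_sub (hint θ t1 t2) ((i1.integrableOn).smul_const C), integral_smul_const,
        hset, e])
  filter_upwards [key, ae_restrict_mem measurableSet_Ioi] with x hx hx0
  exact sub_eq_zero.mp (hx hx0)

lemma IsWeakDeriv.exists_isPrimitive {u p : L2Branch 𝕜} (h : IsWeakDeriv u p) :
    ∃ F : ℝ → 𝕜, Continuous F ∧ u =ᵐ[volume.restrict (Set.Ioi (0 : ℝ))] F ∧ IsPrimitive F p := by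
  obtain ⟨P, hPc, hP, hP0⟩ := exists_continuous_isPrimitive p
  have hPl : LocallyIntegrable P (volume.restrict (Set.Ioi (0 : ℝ))) := hPc.locallyIntegrable
  obtain ⟨C, hC⟩ := ae_eq_const_of_integral_deriv_smul_eq_zero (h := fun x => u x - P x)
    ((locInt u).sub hPl) (by
      intro φ h1 h2 h3
      have hc : Continuous (deriv φ) := h1.continuous_deriv (by simp)
      simp only [smul_sub]
      rw [integral_sub (integrable_smul hc h2.deriv u)
        (hPl.integrable_smul_left_of_hasCompactSupport hc h2.deriv), h φ h1 h2 h3,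
        hP.integral_deriv_smul (Lp.memLp p) h1 h2 h3, sub_self])
  refine ⟨fun x => C + P x, continuous_const.add hPc, ?_, fun x hx => ?_⟩
  · filter_upwards [hC] with x hx
    rw [← hx]; ring
  · simp only
    rw [hP x hx, hP0]; ring

/-- `F` and `P` are the classical representatives of `u` and of its first derivative `p`, where
`r` is the second derivative of `u`. -/
structure IsH2Rep (u p r : L2Branch 𝕜) (F P : ℝ → 𝕜) : Prop where
  hasDerivAt : ∀ x, HasDerivAt F (P x) x
  continuous_deriv : Continuous P
  ae_eq : u =ᵐ[volume.restrict (Set.Ioi (0 : ℝ))] F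
  deriv_ae_eq : p =ᵐ[volume.restrict (Set.Ioi (0 : ℝ))] P
  isPrimitive : IsPrimitive P r

lemma IsWeakDeriv.exists_isH2Rep {u p r : L2Branch 𝕜} (h : IsWeakDeriv u p)
    (h' : IsWeakDeriv p r) : ∃ F P : ℝ → 𝕜, IsH2Rep u p r F P := by
  obtain ⟨F, -, huF, hF⟩ := h.exists_isPrimitive
  obtain ⟨P, hPc, hpP, hP⟩ := h'.exists_isPrimitive
  -- Rebuilding `F` from the continuous `P` makes it differentiable on all of `ℝ`, in particular at
  -- `0`. It is unchanged on `[0, ∞)`.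
  refine ⟨fun x => F 0 + ∫ t in 0..x, P t, P, fun x => ?_, hPc, ?_, hpP, hP⟩
  · exact (intervalIntegral.integral_hasDerivAt_right (hPc.intervalIntegrable _ _)
      hPc.stronglyMeasurable.stronglyMeasurableAtFilter hPc.continuousAt).const_add _
  · filter_upwards [huF, ae_restrict_mem measurableSet_Ioi] with x hx hx0
    rw [hx, (hF.congr hpP) x (le_of_lt hx0)]

namespace IsH2Rep

variable {u p r w q s : L2Branch 𝕜} {F P G Q : ℝ → 𝕜}

lemma isWeakDeriv (h : IsH2Rep u p r F P) : IsWeakDeriv u p :=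
  isWeakDeriv_of_isPrimitive h.ae_eq
    ((isPrimitive_of_hasDerivAt h.hasDerivAt h.continuous_deriv).congr h.deriv_ae_eq.symm)

lemma isWeakDeriv_deriv (h : IsH2Rep u p r F P) : IsWeakDeriv p r :=
  isWeakDeriv_of_isPrimitive h.deriv_ae_eq h.isPrimitive

lemma memH2 (h : IsH2Rep u p r F P) : MemH2 u := ⟨p, h.isWeakDeriv, r, h.isWeakDeriv_deriv⟩

lemma weakDeriv2 (h : IsH2Rep u p r F P) : weakDeriv (weakDeriv u) = r := by
  rw [weakDeriv_eq h.isWeakDeriv, weakDeriv_eq h.isWeakDeriv_deriv]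

lemma contDiff (h : IsH2Rep u p r F P) : ContDiff ℝ 1 F := by
  rw [contDiff_one_iff_deriv]
  refine ⟨fun x => (h.hasDerivAt x).differentiableAt, ?_⟩
  rw [show deriv F = P from funext fun x => (h.hasDerivAt x).deriv]
  exact h.continuous_deriv

lemma add (h : IsH2Rep u p r F P) (h' : IsH2Rep w q s G Q) :
    IsH2Rep (u + w) (p + q) (r + s) (fun x => F x + G x) (fun x => P x + Q x) where
  hasDerivAt x := (h.hasDerivAt x).add (h'.hasDerivAt x)
  continuous_deriv := h.continuous_deriv.add h'.continuous_deriv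
  ae_eq := by
    filter_upwards [Lp.coeFn_add u w, h.ae_eq, h'.ae_eq] with x h1 h2 h3
    rw [h1, Pi.add_apply, h2, h3]
  deriv_ae_eq := by
    filter_upwards [Lp.coeFn_add p q, h.deriv_ae_eq, h'.deriv_ae_eq] with x h1 h2 h3
    rw [h1, Pi.add_apply, h2, h3]
  isPrimitive := by
    refine IsPrimitive.congr (p := fun x => r x + s x) (fun x hx => ?_) (Lp.coeFn_add r s).symm
    rw [intervalIntegral.integral_add
      ((Lp.memLp r).intervalIntegrable_of_restrict_Ioi hx)
      ((Lp.memLp s).intervalIntegrable_of_restrict_Ioi hx), h.isPrimitive x hx,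
      h'.isPrimitive x hx]
    ring

lemma smul (z : 𝕜) (h : IsH2Rep u p r F P) :
    IsH2Rep (z • u) (z • p) (z • r) (fun x => z * F x) (fun x => z * P x) where
  hasDerivAt x := (h.hasDerivAt x).const_mul z
  continuous_deriv := continuous_const.mul h.continuous_deriv
  ae_eq := by
    filter_upwards [Lp.coeFn_smul z u, h.ae_eq] with x h1 h2
    rw [h1, Pi.smul_apply, h2, smul_eq_mul]
  deriv_ae_eq := by
    filter_upwards [Lp.coeFn_smul z p, h.deriv_ae_eq] with x h1 h2
    rw [h1, Pi.smul_apply, h2, smul_eq_mul]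
  isPrimitive := by
    refine IsPrimitive.congr (p := fun x => z * r x) (fun x hx => ?_) (Lp.coeFn_smul z r).symm
    rw [intervalIntegral.integral_const_mul, h.isPrimitive x hx]
    ring

/-- Green's formula on the half-line. -/
lemma inner_add_inner (h : IsH2Rep u p r F P) (h' : IsH2Rep w q s G Q) :
    inner 𝕜 r w + inner 𝕜 p q = -(starRingEnd 𝕜 (P 0) * G 0) := by
  have hm : ∀ f : L2Branch 𝕜, MemLp (fun x => starRingEnd 𝕜 (f x)) 2
      (volume.restrict (Set.Ioi (0 : ℝ))) := fun f => (Lp.memLp f).star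
  have hP2 : MemLp P 2 (volume.restrict (Set.Ioi (0 : ℝ))) := (Lp.memLp p).ae_eq h.deriv_ae_eq
  have key := MemLp.integral_Ioi_mul_add_mul_of_primitive (hm r) (Lp.memLp q)
    (P := fun x => starRingEnd 𝕜 (P x)) hP2.star ((Lp.memLp w).ae_eq h'.ae_eq)
    h.isPrimitive.conj
    ((isPrimitive_of_hasDerivAt h'.hasDerivAt h'.continuous_deriv).congr h'.deriv_ae_eq.symm)
  rw [← key, L2.inner_def, L2.inner_def,
    ← integral_add (L2.integrable_inner r w) (L2.integrable_inner p q)]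
  refine integral_congr_ae ?_
  filter_upwards [h.deriv_ae_eq, h'.ae_eq] with x h1 h2
  rw [RCLike.inner_apply, RCLike.inner_apply, h1, h2]
  ring

lemma eqOn (h : IsH2Rep u p r F P) {v : ℝ → 𝕜} (hv : ContinuousOn v (Set.Ici 0))
    (huv : u =ᵐ[volume.restrict (Set.Ioi (0 : ℝ))] v) : Set.EqOn v F (Set.Ici 0) := by
  have hF : Continuous F := h.contDiff.continuous
  have h1 : Set.EqOn v F (Set.Ioi 0) :=
    Measure.eqOn_open_of_ae_eq (huv.symm.trans h.ae_eq) isOpen_Ioi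
      (hv.mono Set.Ioi_subset_Ici_self) hF.continuousOn
  exact h1.of_subset_closure hv hF.continuousOn Set.Ioi_subset_Ici_self (closure_Ioi (0 : ℝ)).ge

lemma derivWithin_eq (h : IsH2Rep u p r F P) {v : ℝ → 𝕜} (hv : ContinuousOn v (Set.Ici 0))
    (huv : u =ᵐ[volume.restrict (Set.Ioi (0 : ℝ))] v) :
    derivWithin v (Set.Ici 0) 0 = P 0 := by
  rw [derivWithin_congr (h.eqOn hv huv) (h.eqOn hv huv Set.self_mem_Ici)]
  exact (h.hasDerivAt 0).hasDerivWithinAt.derivWithin (uniqueDiffOn_Ici 0 0 Set.self_mem_Ici)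

end IsH2Rep

end StarGraph

namespace StarGraph

/-! ### Solving the equation on a single branch. -/

section Branch

variable {𝕜 : Type*} [RCLike 𝕜]

lemma memLp_ofReal_of_hasCompactSupport {φ : ℝ → ℝ} (h1 : Continuous φ)
    (h2 : HasCompactSupport φ) :
    MemLp (fun x => (φ x : 𝕜)) 2 (volume.restrict (Set.Ioi (0 : ℝ))) :=
  (h1.memLp_of_hasCompactSupport h2).ofReal

lemma inner_toLp_ofReal {φ : ℝ → ℝ}
    (h : MemLp (fun x => (φ x : 𝕜)) 2 (volume.restrict (Set.Ioi (0 : ℝ)))) (f : L2Branch 𝕜) :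
    inner 𝕜 (h.toLp _) f = ∫ x in Set.Ioi (0 : ℝ), φ x • f x := by
  rw [L2.inner_def]
  refine integral_congr_ae ?_
  filter_upwards [h.coeFn_toLp] with x hx
  rw [hx, RCLike.inner_apply, RCLike.conj_ofReal, RCLike.real_smul_eq_coe_mul, mul_comm]

lemma continuous_integral_smul {φ : ℝ → ℝ} (h1 : Continuous φ) (h2 : HasCompactSupport φ) :
    Continuous fun f : L2Branch 𝕜 => ∫ x in Set.Ioi (0 : ℝ), φ x • f x := by
  simp only [← inner_toLp_ofReal (memLp_ofReal_of_hasCompactSupport (𝕜 := 𝕜) h1 h2)]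
  fun_prop

/-- The graph of the weak derivative divided by `l`. -/
def weakDerivGraph (l : 𝕜) : Submodule 𝕜 (WithLp 2 (L2Branch 𝕜 × L2Branch 𝕜)) where
  carrier := {x | IsWeakDeriv x.fst (l • x.snd)}
  zero_mem' := by
    simpa using isWeakDeriv_zero (𝕜 := 𝕜)
  add_mem' {x y} hx hy := by
    have := IsWeakDeriv.add hx hy
    rwa [← smul_add] at this
  smul_mem' z x hx := by
    have := IsWeakDeriv.smul z hx
    rwa [smul_comm] at this

/-- Each test function imposes an equation between continuous functionals on `L²`, and the graph is
the intersection of these conditions. -/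
lemma isClosed_weakDerivGraph (l : 𝕜) :
    IsClosed (weakDerivGraph l : Set (WithLp 2 (L2Branch 𝕜 × L2Branch 𝕜))) := by
  have e : (weakDerivGraph l : Set (WithLp 2 (L2Branch 𝕜 × L2Branch 𝕜))) =
      {x | IsWeakDeriv x.fst (l • x.snd)} := rfl
  rw [e]
  simp only [IsWeakDeriv, Set.ofPred_forall]
  refine isClosed_iInter fun φ => isClosed_iInter fun h1 => isClosed_iInter fun h2 =>
    isClosed_iInter fun h3 => isClosed_eq ?_ ?_
  · exact (continuous_integral_smul (h1.continuous_deriv (by simp)) h2.deriv).comp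
      (WithLp.prod_continuous_ofLp 2 _ _).fst
  · exact ((continuous_integral_smul h1.continuous h2).comp
      ((WithLp.prod_continuous_ofLp 2 _ _).snd.const_smul l)).neg

/-- Project `(g, 0)` orthogonally onto the closed space of pairs `(u, u' / κ)`, that is, minimise
`‖u - g‖ ^ 2 + ‖u'‖ ^ 2 / κ ^ 2`. The Euler-Lagrange equation is `u'' = κ ^ 2 (u - g)`. -/
lemma exists_isWeakDeriv_sub {κ : ℝ} (hκ : κ ≠ 0) (g : L2Branch 𝕜) :
    ∃ u p : L2Branch 𝕜, IsWeakDeriv u p ∧ IsWeakDeriv p (((κ ^ 2 : ℝ) : 𝕜) • (u - g)) := by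
  have hκ' : (κ : 𝕜) ≠ 0 := by exact_mod_cast hκ
  let V := weakDerivGraph (κ : 𝕜)
  have : CompleteSpace V := (isClosed_weakDerivGraph (κ : 𝕜)).completeSpace_coe
  let y : WithLp 2 (L2Branch 𝕜 × L2Branch 𝕜) := WithLp.toLp 2 (g, 0)
  let x := V.starProjection y
  have hx : IsWeakDeriv x.fst ((κ : 𝕜) • x.snd) := V.starProjection_apply_mem y
  have horth : ∀ v ∈ V, inner 𝕜 v (y - x) = 0 := fun v hv =>
    V.sub_starProjection_mem_orthogonal y v hv
  refine ⟨x.fst, (κ : 𝕜) • x.snd, hx, ?_⟩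
  have hw : IsWeakDeriv x.snd ((κ : 𝕜) • (x.fst - g)) := by
    intro φ h1 h2 h3
    have hc := h1.continuous_deriv (n := ∞) (by simp)
    have m0 := memLp_ofReal_of_hasCompactSupport (𝕜 := 𝕜) h1.continuous h2
    have m1 := memLp_ofReal_of_hasCompactSupport (𝕜 := 𝕜) hc h2.deriv
    have hd : ∀ x, HasDerivAt (fun x => ((φ x : ℝ) : 𝕜)) ((deriv φ x : ℝ) : 𝕜) x := fun x =>
      (RCLike.ofRealCLM (K := 𝕜)).hasFDerivAt.comp_hasDerivAt x
        (h1.differentiable (by simp) x).hasDerivAt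
    have hφ : IsWeakDeriv (m0.toLp _) (m1.toLp _) :=
      isWeakDeriv_of_isPrimitive m0.coeFn_toLp
        ((isPrimitive_of_hasDerivAt hd (RCLike.continuous_ofReal.comp hc)).congr
          m1.coeFn_toLp.symm)
    -- Orthogonality to the graph element of a test function is exactly the weak equation for `u' /
    -- κ`.
    have h0 := horth (WithLp.toLp 2 (m0.toLp _, (κ : 𝕜)⁻¹ • m1.toLp _)) (by
      change IsWeakDeriv (m0.toLp _) ((κ : 𝕜) • (κ : 𝕜)⁻¹ • m1.toLp _)
      rwa [smul_inv_smul₀ hκ'])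
    rw [WithLp.prod_inner_apply] at h0
    change inner 𝕜 (m0.toLp _) (g - x.fst) + inner 𝕜 ((κ : 𝕜)⁻¹ • m1.toLp _) (0 - x.snd) = 0 at h0
    rw [zero_sub, inner_neg_right, inner_smul_left, map_inv₀, RCLike.conj_ofReal] at h0
    rw [← inner_toLp_ofReal m1, ← inner_toLp_ofReal m0, inner_smul_right, ← neg_sub g x.fst,
      inner_neg_right]
    field_simp at h0
    linear_combination -h0
  have := hw.smul (κ : 𝕜)
  rwa [smul_smul, ← pow_two, ← RCLike.ofReal_pow] at this

/-- The square-integrable homogeneous solution, with value `1` and slope `-κ` at the vertex; it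
serves to correct boundary data. -/
lemma exists_isH2Rep_exp {κ : ℝ} (hκ : 0 < κ) :
    ∃ e p : L2Branch 𝕜, IsH2Rep e p (((κ ^ 2 : ℝ) : 𝕜) • e)
      (fun x => ((Real.exp (-κ * x) : ℝ) : 𝕜)) (fun x => ((-κ * Real.exp (-κ * x) : ℝ) : 𝕜)) := by
  have hm : MemLp (fun x => ((Real.exp (-κ * x) : ℝ) : 𝕜)) 2
      (volume.restrict (Set.Ioi (0 : ℝ))) := by
    refine MemLp.ofReal ?_
    rw [memLp_two_iff_integrable_sq (by fun_prop)]
    have : (fun x => Real.exp (-κ * x) ^ 2) = fun x => Real.exp (-(2 * κ) * x) := by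
      funext x
      rw [← Real.exp_nat_mul]
      congr 1
      push_cast
      ring
    rw [this]
    exact exp_neg_integrableOn_Ioi 0 (by positivity)
  have hd0 : ∀ x : ℝ, HasDerivAt (fun x => Real.exp (-κ * x)) (-κ * Real.exp (-κ * x)) x :=
    fun x => by
      have h1 : HasDerivAt (fun x => -κ * x) (-κ) x := by
        simpa using (hasDerivAt_id x).const_mul (-κ)
      rw [mul_comm]
      exact h1.exp
  have hd1 : ∀ x : ℝ, HasDerivAt (fun x => -κ * Real.exp (-κ * x))
      (κ ^ 2 * Real.exp (-κ * x)) x := fun x => by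
    have h1 := (hd0 x).const_mul (-κ)
    rwa [← mul_assoc, neg_mul_neg, ← pow_two] at h1
  have hcoe : ∀ {f : ℝ → ℝ} {d x : ℝ}, HasDerivAt f d x →
      HasDerivAt (fun x => ((f x : ℝ) : 𝕜)) (d : 𝕜) x := fun {_ _ x} h =>
    (RCLike.ofRealCLM (K := 𝕜)).hasFDerivAt.comp_hasDerivAt x h
  refine ⟨hm.toLp _, ((-κ : ℝ) : 𝕜) • hm.toLp _, fun x => hcoe (hd0 x),
    RCLike.continuous_ofReal.comp (by fun_prop), hm.coeFn_toLp, ?_, ?_⟩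
  · filter_upwards [Lp.coeFn_smul ((-κ : ℝ) : 𝕜) (hm.toLp _), hm.coeFn_toLp] with x h1 h2
    rw [h1, Pi.smul_apply, h2, smul_eq_mul, RCLike.ofReal_mul]
  · refine (isPrimitive_of_hasDerivAt (fun x => hcoe (hd1 x))
      (RCLike.continuous_ofReal.comp (by fun_prop))).congr ?_
    filter_upwards [Lp.coeFn_smul ((κ ^ 2 : ℝ) : 𝕜) (hm.toLp _), hm.coeFn_toLp] with x h1 h2
    rw [h1, Pi.smul_apply, h2, smul_eq_mul, RCLike.ofReal_mul]

end Branch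

/-! ### The operator on the star: symmetry, lower bound, surjectivity. -/

section Star

variable {𝕜 : Type*} [RCLike 𝕜] {n : ℕ} {c a : Fin n → ℝ}

lemma mem_domain_of_isH2Rep {u : L2Star 𝕜 n} {p r : Fin n → L2Branch 𝕜} {F P : Fin n → ℝ → 𝕜}
    (h : ∀ k, IsH2Rep (u k) (p k) (r k) (F k) (P k)) (h0 : ∀ i k, F i 0 = F k 0)
    (h1 : ∑ k, (c k : 𝕜) * P k 0 = 0) : u ∈ domain 𝕜 c := by
  refine ⟨fun k => (h k).memH2,
    ⟨F, fun k => ⟨(h k).contDiff.continuous.continuousOn, (h k).ae_eq⟩, h0⟩,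
    ⟨F, fun k => ⟨(h k).contDiff.contDiffOn, (h k).ae_eq⟩, ?_⟩⟩
  rw [← h1]
  refine Finset.sum_congr rfl fun k _ => ?_
  rw [(h k).derivWithin_eq (h k).contDiff.continuous.continuousOn (h k).ae_eq]

lemma exists_isH2Rep_of_mem_domain {u : L2Star 𝕜 n} (hu : u ∈ domain 𝕜 c) :
    ∃ (p r : Fin n → L2Branch 𝕜) (F P : Fin n → ℝ → 𝕜),
      (∀ k, IsH2Rep (u k) (p k) (r k) (F k) (P k)) ∧ (∀ i k, F i 0 = F k 0) ∧
        ∑ k, (c k : 𝕜) * P k 0 = 0 := by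
  obtain ⟨hH, ⟨v, hv, hv0⟩, ⟨w, hw, hw0⟩⟩ := hu
  choose p hp r hr using hH
  choose F P hFP using fun k => (hp k).exists_isH2Rep (hr k)
  refine ⟨p, r, F, P, hFP, fun i k => ?_, ?_⟩
  · rw [← (hFP i).eqOn (hv i).1 (hv i).2 Set.self_mem_Ici,
      ← (hFP k).eqOn (hv k).1 (hv k).2 Set.self_mem_Ici, hv0 i k]
  · rw [← hw0]
    refine Finset.sum_congr rfl fun k _ => ?_
    rw [(hFP k).derivWithin_eq (hw k).1.continuousOn (hw k).2]

lemma operator_apply_of_isH2Rep (u : (operator 𝕜 c a).domain) {k : Fin n} {p r : L2Branch 𝕜}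
    {F P : ℝ → 𝕜} (h : IsH2Rep ((u : L2Star 𝕜 n) k) p r F P) :
    operator 𝕜 c a u k = -(c k : 𝕜) • r + (a k : 𝕜) • (u : L2Star 𝕜 n) k := by
  rw [← h.weakDeriv2]
  rfl

/-- The sesquilinear form of the operator. -/
lemma inner_operator_apply {u w : (operator 𝕜 c a).domain} {p r q s : Fin n → L2Branch 𝕜}
    {F P G Q : Fin n → ℝ → 𝕜}
    (hu : ∀ k, IsH2Rep ((u : L2Star 𝕜 n) k) (p k) (r k) (F k) (P k))
    (hP : ∑ k, (c k : 𝕜) * P k 0 = 0)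
    (hw : ∀ k, IsH2Rep ((w : L2Star 𝕜 n) k) (q k) (s k) (G k) (Q k))
    (hG : ∀ i k, G i 0 = G k 0) :
    inner 𝕜 (operator 𝕜 c a u) (w : L2Star 𝕜 n) =
      ∑ k, ((c k : 𝕜) * inner 𝕜 (p k) (q k) +
        (a k : 𝕜) * inner 𝕜 ((u : L2Star 𝕜 n) k) ((w : L2Star 𝕜 n) k)) := by
  rw [PiLp.inner_apply]
  have e : ∀ k, inner 𝕜 (operator 𝕜 c a u k) ((w : L2Star 𝕜 n) k) =
      (c k : 𝕜) * inner 𝕜 (p k) (q k) +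
        (a k : 𝕜) * inner 𝕜 ((u : L2Star 𝕜 n) k) ((w : L2Star 𝕜 n) k) +
      starRingEnd 𝕜 ((c k : 𝕜) * P k 0) * G k 0 := by
    intro k
    rw [operator_apply_of_isH2Rep u (hu k), inner_add_left, inner_smul_left, inner_smul_left,
      map_neg, RCLike.conj_ofReal, RCLike.conj_ofReal, map_mul, RCLike.conj_ofReal]
    linear_combination -(c k : 𝕜) * (hu k).inner_add_inner (hw k)
  rw [Finset.sum_congr rfl fun k _ => e k, Finset.sum_add_distrib]
  -- The common vertex value of `w` factors out of the flux sum of `u`.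
  have hb : ∑ k, starRingEnd 𝕜 ((c k : 𝕜) * P k 0) * G k 0 = 0 := by
    rcases isEmpty_or_nonempty (Fin n) with hn | ⟨⟨i⟩⟩
    · simp
    · simp only [fun k => hG k i]
      rw [← Finset.sum_mul, ← map_sum, hP, map_zero, zero_mul]
  rw [hb, add_zero]

lemma operator_isFormalAdjoint : (operator 𝕜 c a).IsFormalAdjoint (operator 𝕜 c a) := by
  intro u w
  obtain ⟨p, r, F, P, hu, hF, hP⟩ := exists_isH2Rep_of_mem_domain u.2
  obtain ⟨q, s, G, Q, hw, hG, hQ⟩ := exists_isH2Rep_of_mem_domain w.2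
  rw [← inner_conj_symm (u : L2Star 𝕜 n), inner_operator_apply hu hP hw hG,
    inner_operator_apply hw hQ hu hF, map_sum]
  refine Finset.sum_congr rfl fun k _ => ?_
  simp only [map_add, map_mul, RCLike.conj_ofReal, inner_conj_symm]

lemma le_re_inner_operator {m : ℝ} (hc : ∀ k, 0 ≤ c k) (ha : ∀ k, m ≤ a k)
    (u : (operator 𝕜 c a).domain) :
    m * ‖(u : L2Star 𝕜 n)‖ ^ 2 ≤ RCLike.re (inner 𝕜 (u : L2Star 𝕜 n) (operator 𝕜 c a u)) := by
  obtain ⟨p, r, F, P, hu, hF, hP⟩ := exists_isH2Rep_of_mem_domain u.2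
  rw [← operator_isFormalAdjoint u u, inner_operator_apply hu hP hu hF, map_sum,
    PiLp.norm_sq_eq_of_L2, Finset.mul_sum]
  refine Finset.sum_le_sum fun k _ => ?_
  rw [map_add, RCLike.re_ofReal_mul, RCLike.re_ofReal_mul, inner_self_eq_norm_sq,
    inner_self_eq_norm_sq]
  have h1 := mul_nonneg (hc k) (sq_nonneg ‖p k‖)
  have h2 := mul_le_mul_of_nonneg_right (ha k) (sq_nonneg ‖(u : L2Star 𝕜 n) k‖)
  linarith

lemma exists_operator_sub_smul_eq (hc : ∀ k, 0 < c k) {l : ℝ} (hl : ∀ k, l < a k)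
    (f : L2Star 𝕜 n) :
    ∃ u : (operator 𝕜 c a).domain, operator 𝕜 c a u - (l : 𝕜) • (u : L2Star 𝕜 n) = f := by
  have hm : ∀ k, 0 < a k - l := fun k => sub_pos.mpr (hl k)
  -- With `c κ ^ 2 = a - l`, the equation `-c u'' + (a - l) u = f` reads `u'' = κ ^ 2 (u - g)` for
  -- `g = f / (a - l)`.
  set κ : Fin n → ℝ := fun k => Real.sqrt ((a k - l) / c k) with hκ_def
  have hκ : ∀ k, 0 < κ k := fun k => Real.sqrt_pos.mpr (div_pos (hm k) (hc k))
  have hκ2 : ∀ k, c k * κ k ^ 2 = a k - l := fun k => by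
    rw [hκ_def, Real.sq_sqrt (div_pos (hm k) (hc k)).le, mul_div_cancel₀ _ (hc k).ne']
  choose u p hu hp using fun k =>
    exists_isWeakDeriv_sub (𝕜 := 𝕜) (hκ k).ne' (((a k - l : ℝ) : 𝕜)⁻¹ • f k)
  choose F P hFP using fun k => (hu k).exists_isH2Rep (hp k)
  choose e q he using fun k => exists_isH2Rep_exp (𝕜 := 𝕜) (hκ k)
  set S : 𝕜 := ∑ k, (c k : 𝕜) * (κ k : 𝕜) with hS
  -- `t` is the common vertex value. Adding `t - F k 0` times the exponential on each branch
  -- produces it, and the flux condition becomes linear in `t` with coefficient `-S`; this is its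
  -- solution.
  set t : 𝕜 := (∑ k, (c k : 𝕜) * (P k 0 + (κ k : 𝕜) * F k 0)) / S with ht
  have hrep := fun k => (hFP k).add ((he k).smul (t - F k 0))
  let U : L2Star 𝕜 n := WithLp.toLp 2 fun k => u k + (t - F k 0) • e k
  have hU : U ∈ domain 𝕜 c := by
    refine mem_domain_of_isH2Rep hrep (fun i k => by simp) ?_
    rcases isEmpty_or_nonempty (Fin n) with hn | hn
    · simp
    have hS0 : S ≠ 0 := by
      have : S = ((∑ k, c k * κ k : ℝ) : 𝕜) := by rw [hS]; push_cast; rfl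
      rw [this]
      exact_mod_cast (Finset.sum_pos (fun k _ => mul_pos (hc k) (hκ k))
        Finset.univ_nonempty).ne'
    have hexp : ∀ k, (c k : 𝕜) * (P k 0 + (t - F k 0) *
        ((-κ k * Real.exp (-κ k * 0) : ℝ) : 𝕜)) =
        (c k : 𝕜) * (P k 0 + (κ k : 𝕜) * F k 0) - t * ((c k : 𝕜) * (κ k : 𝕜)) := fun k => by
      rw [mul_zero, Real.exp_zero, mul_one, RCLike.ofReal_neg]
      ring
    rw [Finset.sum_congr rfl fun k _ => hexp k, Finset.sum_sub_distrib, ← Finset.mul_sum, ← hS, ht,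
      div_mul_cancel₀ _ hS0, sub_self]
  refine ⟨⟨U, hU⟩, ?_⟩
  ext1 k
  have hk := operator_apply_of_isH2Rep (a := a) ⟨U, hU⟩ (hrep k)
  rw [PiLp.sub_apply, PiLp.smul_apply, hk]
  change -(c k : 𝕜) • (((κ k ^ 2 : ℝ) : 𝕜) • (u k - ((a k - l : ℝ) : 𝕜)⁻¹ • f k) +
    (t - F k 0) • ((κ k ^ 2 : ℝ) : 𝕜) • e k) + (a k : 𝕜) • (u k + (t - F k 0) • e k) -
      (l : 𝕜) • (u k + (t - F k 0) • e k) = f k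
  have hk2 : (c k : 𝕜) * ((κ k ^ 2 : ℝ) : 𝕜) = ((a k - l : ℝ) : 𝕜) := by
    rw [← RCLike.ofReal_mul, hκ2]
  have hm0 : ((a k - l : ℝ) : 𝕜) ≠ 0 := by exact_mod_cast (hm k).ne'
  have hf : f k = ((a k - l : ℝ) : 𝕜) • ((a k - l : ℝ) : 𝕜)⁻¹ • f k := (smul_inv_smul₀ hm0 _).symm
  set g := ((a k - l : ℝ) : 𝕜)⁻¹ • f k
  rw [hf, ← hk2]
  have hal : (a k : 𝕜) = (l : 𝕜) + (c k : 𝕜) * ((κ k ^ 2 : ℝ) : 𝕜) := by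
    rw [hk2]; push_cast; ring
  rw [hal]
  module

end Star

end StarGraph

theorem proposition2p1 {𝕜 : Type*} [RCLike 𝕜] {n : ℕ} (hn : 2 ≤ n) (c a : Fin n → ℝ)
    (hc : ∀ k, 0 < c k) (ha : Monotone a) (ha0 : 0 ≤ a ⟨0, by omega⟩) :
    IsSelfAdjoint (StarGraph.operator 𝕜 c a) ∧
      StarGraph.spectrum (StarGraph.operator 𝕜 c a) ⊆
        (fun r : ℝ => (r : 𝕜)) '' Set.Ici (a ⟨0, by omega⟩) := by
  have hmin : ∀ k, a ⟨0, by omega⟩ ≤ a k := fun k => ha (Fin.mk_le_of_le_val (Nat.zero_le _))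
  -- Any real number below the smallest potential would serve as `l`; here it is that potential
  -- minus one.
  exact StarGraph.operator_isFormalAdjoint.isSelfAdjoint_and_spectrum_subset
    (sub_one_lt (a ⟨0, by omega⟩))
    (StarGraph.le_re_inner_operator (fun k => (hc k).le) hmin)
    (StarGraph.exists_operator_sub_smul_eq hc fun k => (sub_one_lt _).trans_le (hmin k))
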